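/- Let $\Omega\subset\mathbb{R}^2$ be an open set containing the origin $O$. Write $\mathcal{D}'(\Omega,F)$ for the distributions on $\Omega$ with values in a finite-dimensional real vector space $F$, and $\operatorname{Sym}$ for the symmetric linear maps of $\mathbb{R}^2$. Let $\mathcal{A}(\Omega,F)$ be the set of $T\in\mathcal{D}'(\Omega,F)$ with singular support contained in $\{O\}$; the restriction $T|_{\Omega-O}$ of such a $T$ is given by a smooth map $\Omega-O\to F$, denoted by the same symbol. Let $\mathcal{E}(\Omega,F)$ be the set of $T\in\mathcal{D}'(\Omega,F)$ with support contained in $\{O\}$. For $T\in\mathcal{D}'(\Omega,F)$ and open balls $B_r\subset\Omega$ centred at $O$, put $(T|_{B_r})_\lambda(\phi)=T(\phi_\lambda)$ for $0<\lambda<1$ and $\phi\in\mathcal{D}(B_r)$, where $\phi_\lambda(x)=\lambda^{-2}\phi(x/\lambda)$ (extended by zero). The degree of divergence of $T$ at $O$ is the extended real number $$\operatorname{deg}T=\inf\{k\in\mathbb{R}\;:\;\lim_{\lambda\to0^+}\lambda^k(T|_{B_r})_\lambda=0\ \text{in the sense of distributions}\}-2,$$ the condition on $k$ being independent of the ball $B_r\subset\Omega$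 (so $\operatorname{deg}0=-\infty$). Let $\sigma\in\mathcal{A}(\Omega,\operatorname{Sym})$, and let $B\in\mathcal{E}(\Omega,\mathbb{R}^2)$ have the representation $B=\sum_{\alpha\in\mathbb{N}^2}b^\alpha\,\partial^\alpha\delta_O$ with $b^\alpha\in\mathbb{R}^2$, only finitely many of them non-zero. Let $\operatorname{Div}\sigma\in\mathcal{D}'(\Omega,\mathbb{R}^2)$ be the distributional divergence, $(\operatorname{Div}\sigma)_i=\sum_j\partial_j\sigma_{ij}$, and $\operatorname{div}$ the pointwise one. Let $\varepsilon>0$ be such that the closed ball of radius $\varepsilon$ about $O$ lies in $\Omega$, and let $n$ be the outward unit normal to $\partial B_\varepsilon$. (a) The equilibrium condition $\operatorname{Div}\sigma+B=0$ in $\mathcal{D}'(\Omega,\mathbb{R}^2)$ implies $$\text{(i)}\ \operatorname{div}(\sigma|_{\Omega-O})=0\ \text{in }\Omega-O,\qquad \text{(ii)}\ \int_{\partial B_\varepsilon}\sigma|_{\Omega-O}\,n\,dl=-b^{(0,0)},\qquad \text{(iii)}\ \operatorname{deg}B\le\operatorname{deg}\sigma+1.$$ (b) If $\operatorname{deg}\sigma<0$,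 then $\operatorname{Div}\sigma+B=0$ holds if and only if (i), (ii) and (iii) all hold. -/

import Mathlib

open Set Filter Topology MeasureTheory TopologicalSpace
open scoped Distributions ContDiff LineDeriv

noncomputable section

namespace PlaneStress

/-- The Euclidean plane; the distinguished point `O` is its origin `0`. -/
abbrev Plane := EuclideanSpace ℝ (Fin 2)

/-- The standard orthonormal basis vectors of the plane. -/
abbrev e (j : Fin 2) : Plane := EuclideanSpace.single j 1

/-- The unit vector at angle `θ`, which is the outward unit normal of `∂B_ε` at `ε • normal θ`. -/
def normal (θ : ℝ) : Plane := !₂[Real.cos θ, Real.sin θ]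

/-- The symmetric linear maps of the plane to itself. -/
abbrev SymLin := selfAdjoint.submodule ℝ (Plane →L[ℝ] Plane)

section Distributions

variable {Ω : Opens Plane} {F : Type*} [AddCommGroup F] [Module ℝ F] [TopologicalSpace F]
  [IsTopologicalAddGroup F] [ContinuousSMul ℝ F]

/-- The restriction of a distribution on `Ω` to an open set `U ≤ Ω`: it is evaluated on the
extension by zero of a test function on `U` (and is the zero distribution if not `U ≤ Ω`). -/
def restrictTo (U : Opens Plane) (T : 𝓓'(Ω, F)) : 𝓓'(U, F) :=
  (TestFunction.monoCLM ℝ : 𝓓(U, ℝ) →L[ℝ] 𝓓(Ω, ℝ)).precompCompactConvergenceCLM F T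

/-- The support of `T`, as a relatively closed subset of `Ω`. -/
def supp (T : 𝓓'(Ω, F)) : Set Plane :=
  Distribution.dsupport T ∩ Ω

variable (Ω F) in
/-- The fields `ℰ(Ω, F)` supported at the origin. -/
def PointField : Set 𝓓'(Ω, F) := {T | supp T ⊆ {0}}

/-- `Ω - O`. -/
def punctured (Ω : Opens Plane) : Opens Plane :=
  ⟨(Ω : Set Plane) \ {0}, Ω.isOpen.sdiff isClosed_singleton⟩

/-- The open ball `B_r` about the origin. -/
def ballO (r : ℝ) : Opens Plane := ⟨Metric.ball 0 r, Metric.isOpen_ball⟩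

/-- The rescaled function `φ_l(x) = l⁻² φ(x / l)`. -/
def rescaleFun (l : ℝ) (φ : Plane → ℝ) (x : Plane) : ℝ := (l ^ 2)⁻¹ * φ (l⁻¹ • x)

theorem tsupport_rescaleFun_subset (l : ℝ) (φ : Plane → ℝ) :
    tsupport (rescaleFun l φ) ⊆ (fun x : Plane => l⁻¹ • x) ⁻¹' tsupport φ := by
  refine closure_minimal ?_ ((isClosed_tsupport φ).preimage (continuous_const_smul _))
  intro x hx
  refine subset_tsupport φ ?_
  intro h0
  exact hx (by simp [rescaleFun, h0])

open Classical in
/-- The rescaled test function `φ_l` of `φ ∈ 𝓓(B_r)`, for `0 < l < 1` (and `0` for other `l`,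
which play no role in limits as `l → 0+`). -/
def rescale {r : ℝ} (l : ℝ) (φ : 𝓓(ballO r, ℝ)) : 𝓓(ballO r, ℝ) :=
  if h : 0 < l ∧ l < 1 then
    { toFun := rescaleFun l φ
      contDiff' := contDiff_const.mul (φ.contDiff.comp (contDiff_const_smul _))
      hasCompactSupport' := by
        have h1 : IsCompact ((fun x : Plane => l⁻¹ • x) ⁻¹' tsupport φ) :=
          (Homeomorph.smulOfNeZero l⁻¹ (inv_ne_zero h.1.ne')).isCompact_preimage.2
            φ.hasCompactSupport
        exact h1.of_isClosed_subset (isClosed_tsupport _) (tsupport_rescaleFun_subset l φ)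
      tsupport_subset' := by
        intro x hx
        have h2 : l⁻¹ • x ∈ Metric.ball (0 : Plane) r :=
          φ.tsupport_subset (tsupport_rescaleFun_subset l φ hx)
        rw [mem_ball_zero_iff, norm_smul, norm_inv, Real.norm_of_nonneg h.1.le,
          inv_mul_lt_iff₀ h.1] at h2
        have h3 : 0 < r := by
          by_contra hr
          nlinarith [norm_nonneg x, h.1]
        have h4 : ‖x‖ < r := by nlinarith [h.2]
        exact mem_ball_zero_iff.2 h4 }
  else 0

/-- The scaling degree of `T` at the origin: the infimum of the real `k` with
`l ^ k • (T|_{B_r})_l → 0` as `l → 0+`, in the sense of distributions on the balls `B_r ⊆ Ω`. (By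
locality the condition does not depend on the ball.) It is an extended real number, since it is
`-∞` for the zero distribution. -/
def scalingDegree (T : 𝓓'(Ω, F)) : EReal :=
  ⨅ k ∈ {k : ℝ | ∀ r : ℝ, 0 < r → ballO r ≤ Ω → ∀ φ : 𝓓(ballO r, ℝ),
    Tendsto (fun l : ℝ => l ^ k • restrictTo (ballO r) T (rescale l φ)) (𝓝[>] 0) (𝓝 0)}, (k : EReal)

/-- The degree of divergence at the origin, `sd T - 2` in the plane. -/
def deg (T : 𝓓'(Ω, F)) : EReal := scalingDegree T - 2

/-- The partial derivative `∂^α δ_O` of the Dirac measure at the origin. -/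
def deltaDeriv (Ω : Opens Plane) (α : ℕ × ℕ) : 𝓓'(Ω, ℝ) :=
  (fun T : 𝓓'(Ω, ℝ) => ∂_{e 0} T)^[α.1]
    ((fun T : 𝓓'(Ω, ℝ) => ∂_{e 1} T)^[α.2] (Distribution.delta 0))

/-- The vector valued distribution `v T`, for a vector `v` and a scalar distribution `T`. -/
def vecMul (v : F) (T : 𝓓'(Ω, ℝ)) : 𝓓'(Ω, F) :=
  Distribution.mapCLM (ContinuousLinearMap.toSpanSingleton ℝ v) T

end Distributions

section Smooth

variable {Ω : Opens Plane} {F : Type*} [NormedAddCommGroup F] [NormedSpace ℝ F]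

/-- The map `f` is smooth on `U`, and the distribution `T` is integration against `f`. -/
def IsSmoothDensity {U : Opens Plane} (T : 𝓓'(U, F)) (f : Plane → F) : Prop :=
  ContDiffOn ℝ ∞ f U ∧ ∀ ψ : 𝓓(U, ℝ), T ψ = ∫ x in (U : Set Plane), ψ x • f x

/-- `T` is smooth at `x`: it is given by a smooth map on some open neighbourhood of `x`. -/
def SmoothAt (T : 𝓓'(Ω, F)) (x : Plane) : Prop :=
  ∃ U : Opens Plane, U ≤ Ω ∧ x ∈ U ∧ ∃ f : Plane → F, IsSmoothDensity (restrictTo U T) f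

/-- The singular support: the closure, relative to `Ω`, of the set of points of `Ω` at which `T`
is not smooth. -/
def singSupp (T : 𝓓'(Ω, F)) : Set Plane :=
  closure {x | x ∈ Ω ∧ ¬ SmoothAt T x} ∩ Ω

variable (Ω F) in
/-- The fields `𝒜(Ω, F)` which are smooth away from the origin. -/
def SingularField : Set 𝓓'(Ω, F) := {T | singSupp T ⊆ {0}}

end Smooth

/-- `A ↦ A v` on symmetric maps. -/
def evalSym (v : Plane) : SymLin →L[ℝ] Plane :=
  (ContinuousLinearMap.apply ℝ Plane v).comp SymLin.subtypeL

/-- The distributional divergence of a stress field, `(Div σ)_i = ∂_j σ_{ij}`. -/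
def tensorDiv {Ω : Opens Plane} (σ : 𝓓'(Ω, SymLin)) : 𝓓'(Ω, Plane) :=
  ∑ j : Fin 2, ∂_{e j} (Distribution.mapCLM (evalSym (e j)) σ)

/-- The pointwise divergence of a tensor map, `(div f)_i = ∂_j f_{ij}`. -/
def divergence (f : Plane → SymLin) (x : Plane) : Plane :=
  ∑ j : Fin 2, evalSym (e j) (fderiv ℝ f x (e j))

/-- The flux `∫_{∂B_ε} f n dl`, with the circle parametrized by the angle, `dl = ε dθ`. -/
def loopIntegral (f : Plane → SymLin) (ε : ℝ) : Plane :=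
  ∫ θ in (0 : ℝ)..(2 * Real.pi), ε • evalSym (normal θ) (f (ε • normal θ))

end PlaneStress

end

/-!
Away from the origin `Div σ` is integration against the pointwise divergence, so equilibrium there
is the vanishing of that divergence. Near the origin three facts decide the matter.

* Differentiation raises the scaling degree by at most one, whence the bound on `deg B`
  (`deg_neg_tensorDiv_le`).
* Tested against a radial function which is constant near the origin, `Div σ` is a weighted average
  over `r` of the fluxes through the circles of radius `r`
  (`exists_tensorDiv_apply_eq_integral_loopIntegral`), while `B` only sees the coefficient
  `b (0, 0)`. As the weight is arbitrary and the flux is continuous in `r`, the flux through each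
  single circle is determined (`loopIntegral_eq_of_tensorDiv_apply`).
* A distribution supported at the origin with scaling degree below `3` is a multiple of the Dirac
  measure (`VanishesOffOrigin.exists_eq_smul`). Scaling shows that it kills the cut-off homogeneous
  functions of positive degree; its order being finite, it also kills all functions vanishing to
  high order; Hadamard's lemma `g x = g 0 + ∑ x_j g_j x` connects the two by descent on the degree.

For the converse, let `deg σ < 0`. The residual `Div σ + B` is supported at the origin because the
divergence vanishes elsewhere, and its scaling degree is below `3` by the bound on `deg B`. Hence it
is `c δ` for a vector `c`, and the flux is `c - b (0, 0)`; the flux condition forces `c = 0`.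
-/

noncomputable section

namespace PlaneStress

/-! ### Test functions and smooth densities -/

section TestFunctions

variable {E : Type*} [NormedAddCommGroup E] [NormedSpace ℝ E] {Ω : Opens E}

/-- The product `φ g` of a test function `φ` and a smooth function `g`. -/
def mulSmooth (φ : 𝓓(Ω, ℝ)) (g : E → ℝ) (hg : ContDiff ℝ ∞ g) : 𝓓(Ω, ℝ) where
  toFun x := φ x * g x
  contDiff' := φ.contDiff.mul hg
  hasCompactSupport' := φ.hasCompactSupport.mul_right
  tsupport_subset' := (tsupport_mul_subset_left (f := φ) (g := g)).trans φ.tsupport_subset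

@[simp]
theorem mulSmooth_apply (φ : 𝓓(Ω, ℝ)) (g : E → ℝ) (hg : ContDiff ℝ ∞ g) (x : E) :
    mulSmooth φ g hg x = φ x * g x := rfl

theorem tsupport_mulSmooth_subset (φ : 𝓓(Ω, ℝ)) (g : E → ℝ) (hg : ContDiff ℝ ∞ g) :
    tsupport (mulSmooth φ g hg) ⊆ tsupport φ ∩ tsupport g :=
  subset_inter (tsupport_mul_subset_left (f := φ) (g := g))
    (tsupport_mul_subset_right (f := φ) (g := g))

/-- A test function on `Ω` whose support lies in `U`, as a test function on `U`. -/
def shrink (φ : 𝓓(Ω, ℝ)) (U : Opens E) (h : tsupport φ ⊆ U) : 𝓓(U, ℝ) where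
  toFun := φ
  contDiff' := φ.contDiff
  hasCompactSupport' := φ.hasCompactSupport
  tsupport_subset' := h

@[simp]
theorem shrink_apply (φ : 𝓓(Ω, ℝ)) (U : Opens E) (h : tsupport φ ⊆ U) (x : E) :
    shrink φ U h x = φ x := rfl

/-- The extension by zero of a test function on `U` to a test function on `Ω ⊇ U`. -/
def extendTo {U : Opens E} (hU : U ≤ Ω) (ψ : 𝓓(U, ℝ)) : 𝓓(Ω, ℝ) where
  toFun := ψ
  contDiff' := ψ.contDiff
  hasCompactSupport' := ψ.hasCompactSupport
  tsupport_subset' := ψ.tsupport_subset.trans hU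

@[simp]
theorem extendTo_apply {U : Opens E} (hU : U ≤ Ω) (ψ : 𝓓(U, ℝ)) (x : E) :
    extendTo hU ψ x = ψ x := rfl

theorem lineDeriv_apply (φ : 𝓓(Ω, ℝ)) (v x : E) : (∂_{v} φ : 𝓓(Ω, ℝ)) x = fderiv ℝ φ x v := by
  have h : (∂_{v} φ : 𝓓(Ω, ℝ)) = TestFunction.lineDerivCLM ℝ v φ := rfl
  rw [h, TestFunction.lineDerivCLM_eq_fderivCLM, TestFunction.fderivCLM_apply_of_le _ (by simp)]

theorem tsupport_lineDeriv_subset (φ : 𝓓(Ω, ℝ)) (v : E) :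
    tsupport (∂_{v} φ : 𝓓(Ω, ℝ)) ⊆ tsupport φ := by
  have h : ⇑(∂_{v} φ : 𝓓(Ω, ℝ)) = fun x => fderiv ℝ φ x v := funext (lineDeriv_apply φ v)
  rw [h]
  refine closure_minimal (fun x hx => ?_) (isClosed_tsupport _)
  refine tsupport_fderiv_subset ℝ (subset_tsupport _ fun h0 => hx ?_)
  simp [h0]

theorem restrictTo_apply {Ω U : Opens Plane} {F : Type*} [AddCommGroup F] [Module ℝ F]
    [TopologicalSpace F] [IsTopologicalAddGroup F] [ContinuousSMul ℝ F] (hU : U ≤ Ω)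
    (T : 𝓓'(Ω, F)) (ψ : 𝓓(U, ℝ)) :
    restrictTo U T ψ = T (extendTo hU ψ) := by
  have h1 : restrictTo U T ψ = T (TestFunction.monoCLM ℝ ψ : 𝓓(Ω, ℝ)) := rfl
  rw [h1]
  congr 1
  ext x
  simp [hU]

end TestFunctions

section Densities

variable {Ω U : Opens Plane} {F : Type*} [NormedAddCommGroup F] [NormedSpace ℝ F]

theorem apply_eq_integral (hU : U ≤ Ω) {T : 𝓓'(Ω, F)} {f : Plane → F}
    (hf : IsSmoothDensity (restrictTo U T) f) (φ : 𝓓(Ω, ℝ)) (hφ : tsupport φ ⊆ U) :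
    T φ = ∫ x, φ x • f x := by
  rw [show φ = extendTo hU (shrink φ U hφ) from rfl, ← restrictTo_apply hU, hf.2]
  refine setIntegral_eq_integral_of_forall_compl_eq_zero fun x hx => ?_
  have h0 : φ x = 0 := image_eq_zero_of_notMem_tsupport fun h => hx (hφ h)
  rw [shrink_apply, h0, zero_smul]

theorem integrable_smul_of_tsupport_subset {E : Type*} [NormedAddCommGroup E] [NormedSpace ℝ E]
    [MeasurableSpace E] [BorelSpace E] {μ : Measure E} [IsFiniteMeasureOnCompacts μ] {V : Set E}
    (hV : IsOpen V) {ψ : E → ℝ} (hψ : Continuous ψ) (hc : HasCompactSupport ψ)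
    (hs : tsupport ψ ⊆ V) {f : E → F} (hf : ContinuousOn f V) :
    Integrable (fun x => ψ x • f x) μ := by
  have h1 : tsupport (fun x => ψ x • f x) ⊆ tsupport ψ := tsupport_smul_subset_left ψ f
  have h2 : Continuous (fun x => ψ x • f x) :=
    (hψ.continuousOn.smul hf).continuous_of_tsupport_subset hV (h1.trans hs)
  exact h2.integrable_of_hasCompactSupport hc.smul_right

theorem mapCLM_apply_eq_integral [FiniteDimensional ℝ F] {G : Type*} [NormedAddCommGroup G]
    [NormedSpace ℝ G] [CompleteSpace G] (hU : U ≤ Ω) {T : 𝓓'(Ω, F)} {f : Plane → F}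
    (hf : IsSmoothDensity (restrictTo U T) f) (A : F →L[ℝ] G) (φ : 𝓓(Ω, ℝ))
    (hφ : tsupport φ ⊆ U) :
    Distribution.mapCLM A T φ = ∫ x, φ x • A (f x) := by
  have := FiniteDimensional.complete ℝ F
  rw [Distribution.mapCLM_apply, apply_eq_integral hU hf φ hφ, ← A.integral_comp_comm]
  · simp
  · exact integrable_smul_of_tsupport_subset U.isOpen φ.continuous φ.hasCompactSupport hφ
      hf.1.continuousOn

theorem continuousOn_clm_fderiv_apply {G : Type*} [NormedAddCommGroup G] [NormedSpace ℝ G]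
    {f : Plane → F} (hf : ContDiffOn ℝ ∞ f U) (A : F →L[ℝ] G) (v : Plane) :
    ContinuousOn (fun x => A (fderiv ℝ f x v)) U :=
  A.continuous.comp_continuousOn
    ((hf.continuousOn_fderiv_of_isOpen U.isOpen (by simp)).clm_apply continuousOn_const)

theorem neg_integral_fderiv_smul_clm {G : Type*} [NormedAddCommGroup G] [NormedSpace ℝ G]
    {f : Plane → F} (hf : ContDiffOn ℝ ∞ f U) (A : F →L[ℝ] G) (φ : 𝓓(Ω, ℝ))
    (hφ : tsupport φ ⊆ U) (v : Plane) :
    -∫ x, fderiv ℝ φ x v • A (f x) = ∫ x, φ x • A (fderiv ℝ f x v) := by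
  have hd : ∀ x ∈ (U : Set Plane), DifferentiableAt ℝ f x := fun x hx =>
    (hf.contDiffAt (U.isOpen.mem_nhds hx)).differentiableAt (by simp)
  have hfc : ContinuousOn (fun x => A (f x)) U := A.continuous.comp_continuousOn hf.continuousOn
  have heq : (fun x => φ x • fderiv ℝ (fun y => A (f y)) x v) =
      fun x => φ x • A (fderiv ℝ f x v) := by
    funext x
    by_cases hx : x ∈ tsupport φ
    · have := A.hasFDerivAt.comp x (hd x (hφ hx)).hasFDerivAt
      rw [show (fun y => A (f y)) = A ∘ f from rfl, this.fderiv]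
      rfl
    · simp [image_eq_zero_of_notMem_tsupport hx]
  rw [← heq, integral_smul_fderiv_eq_neg_fderiv_smul_of_integrable]
  · have h := integrable_smul_of_tsupport_subset (μ := volume) U.isOpen
      (∂_{v} φ : 𝓓(Ω, ℝ)).continuous (∂_{v} φ : 𝓓(Ω, ℝ)).hasCompactSupport
      ((tsupport_lineDeriv_subset φ _).trans hφ) hfc
    simpa only [lineDeriv_apply] using h
  · rw [heq]
    exact integrable_smul_of_tsupport_subset U.isOpen φ.continuous φ.hasCompactSupport hφ
      (continuousOn_clm_fderiv_apply hf A v)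
  · exact integrable_smul_of_tsupport_subset U.isOpen φ.continuous φ.hasCompactSupport hφ hfc
  · exact fun x _ => (φ.contDiff.differentiable (by simp)) x
  · exact fun x hx => A.differentiableAt.comp x (hd x (hφ hx))

theorem tensorDiv_apply {σ : 𝓓'(Ω, SymLin)} (φ : 𝓓(Ω, ℝ)) :
    tensorDiv σ φ = - ∑ j : Fin 2, evalSym (e j) (σ (∂_{e j} φ)) := by
  rw [← Finset.sum_neg_distrib, tensorDiv, Fin.sum_univ_two, Fin.sum_univ_two]
  rfl

/-- The divergence tested against a function whose gradient is supported where the stress is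
smooth; the function itself may be non-zero at the singularity. -/
theorem tensorDiv_apply_eq_integral_gradient (hU : U ≤ Ω) {σ : 𝓓'(Ω, SymLin)} {f : Plane → SymLin}
    (hf : IsSmoothDensity (restrictTo U σ) f) (φ : 𝓓(Ω, ℝ))
    (hφ : ∀ j, tsupport (∂_{e j} φ : 𝓓(Ω, ℝ)) ⊆ U) :
    tensorDiv σ φ = - ∑ j : Fin 2, ∫ x, fderiv ℝ φ x (e j) • evalSym (e j) (f x) := by
  rw [tensorDiv_apply]
  congr 1
  refine Finset.sum_congr rfl fun j _ => ?_
  have h := mapCLM_apply_eq_integral hU hf (evalSym (e j)) _ (hφ j)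
  rw [Distribution.mapCLM_apply] at h
  rw [h]
  simp only [lineDeriv_apply]

theorem continuousOn_divergence {f : Plane → SymLin} (hf : ContDiffOn ℝ ∞ f U) :
    ContinuousOn (divergence f) U :=
  continuousOn_finsetSum _ fun j _ => continuousOn_clm_fderiv_apply hf (evalSym (e j)) (e j)

theorem tensorDiv_apply_eq_integral_divergence (hU : U ≤ Ω) {σ : 𝓓'(Ω, SymLin)}
    {f : Plane → SymLin} (hf : IsSmoothDensity (restrictTo U σ) f) (φ : 𝓓(Ω, ℝ))
    (hφ : tsupport φ ⊆ U) :
    tensorDiv σ φ = ∫ x, φ x • divergence f x := by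
  rw [tensorDiv_apply_eq_integral_gradient hU hf φ
    fun j => (tsupport_lineDeriv_subset φ _).trans hφ, ← Finset.sum_neg_distrib]
  calc ∑ j : Fin 2, -∫ x, fderiv ℝ φ x (e j) • evalSym (e j) (f x)
      = ∑ j : Fin 2, ∫ x, φ x • evalSym (e j) (fderiv ℝ f x (e j)) :=
        Finset.sum_congr rfl fun j _ => neg_integral_fderiv_smul_clm hf.1 (evalSym (e j)) φ hφ (e j)
    _ = ∫ x, φ x • divergence f x := by
        rw [← integral_finsetSum _ fun j _ => integrable_smul_of_tsupport_subset U.isOpen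
          φ.continuous φ.hasCompactSupport hφ
          (continuousOn_clm_fderiv_apply hf.1 (evalSym (e j)) (e j))]
        simp only [divergence, Finset.smul_sum]

/-- A continuous map which integrates to zero against all test functions vanishes. -/
theorem eqOn_zero_of_integral_smul_eq_zero [CompleteSpace F] {f : Plane → F}
    (hf : ContinuousOn f U)
    (h : ∀ φ : 𝓓(U, ℝ), ∫ x, φ x • f x = 0) : EqOn f 0 U := by
  have h1 : ∀ᵐ x, x ∈ (U : Set Plane) → f x = 0 :=
    U.isOpen.ae_eq_zero_of_integral_contDiff_smul_eq_zero
      (hf.locallyIntegrableOn U.isOpen.measurableSet) fun g hg hc hs => h ⟨g, hg, hc, hs⟩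
  exact Measure.eqOn_open_of_ae_eq ((ae_restrict_iff' U.isOpen.measurableSet).2 h1) U.isOpen hf
    continuousOn_const

end Densities

/-! ### Gluing local densities -/

section Gluing

variable {Ω U V : Opens Plane} {F : Type*} [NormedAddCommGroup F] [NormedSpace ℝ F]

theorem IsSmoothDensity.eqOn [CompleteSpace F] {T : 𝓓'(Ω, F)} (hU : U ≤ Ω) (hV : V ≤ Ω)
    {f g : Plane → F} (hf : IsSmoothDensity (restrictTo U T) f)
    (hg : IsSmoothDensity (restrictTo V T) g) : EqOn f g (U ∩ V) := by
  have hfc : ContinuousOn f (U ⊓ V : Opens Plane) := hf.1.continuousOn.mono inter_subset_left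
  have hgc : ContinuousOn g (U ⊓ V : Opens Plane) := hg.1.continuousOn.mono inter_subset_right
  have h0 : EqOn (f - g) 0 (U ⊓ V : Opens Plane) := by
    refine eqOn_zero_of_integral_smul_eq_zero (hfc.sub hgc) fun φ => ?_
    have hφU : tsupport φ ⊆ U := φ.tsupport_subset.trans inter_subset_left
    have hφV : tsupport φ ⊆ V := φ.tsupport_subset.trans inter_subset_right
    let φ' : 𝓓(Ω, ℝ) := extendTo (inf_le_left.trans hU) φ
    have h1 : T φ' = ∫ x, φ x • f x := apply_eq_integral hU hf φ' hφU
    have h2 : T φ' = ∫ x, φ x • g x := apply_eq_integral hV hg φ' hφV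
    simp only [Pi.sub_apply, smul_sub]
    rw [integral_sub, ← h1, ← h2, sub_self]
    · exact integrable_smul_of_tsupport_subset U.isOpen φ.continuous φ.hasCompactSupport hφU
        hf.1.continuousOn
    · exact integrable_smul_of_tsupport_subset V.isOpen φ.continuous φ.hasCompactSupport hφV
        hg.1.continuousOn
  intro x hx
  exact sub_eq_zero.1 (h0 hx)

/-- Local smooth densities agree on overlaps, so they glue; a partition of unity on the support of
a test function shows that the glued map is again a density. -/
theorem exists_isSmoothDensity_of_forall_smoothAt [CompleteSpace F] {T : 𝓓'(Ω, F)} (hV : V ≤ Ω)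
    (h : ∀ x ∈ V, SmoothAt T x) : ∃ f : Plane → F, IsSmoothDensity (restrictTo V T) f := by
  classical
  choose! W hWΩ hxW g hg using h
  have hagree : ∀ y ∈ V, EqOn (fun x => g x x) (g y) (V ∩ W y) := fun y hy x hx =>
    (hg x hx.1).eqOn (hWΩ x hx.1) (hWΩ y hy) (hg y hy) ⟨hxW x hx.1, hx.2⟩
  have hsmooth : ContDiffOn ℝ ∞ (fun x => g x x) V := by
    intro y hy
    refine ContDiffAt.contDiffWithinAt ?_
    refine ((hg y hy).1.contDiffAt ((W y).isOpen.mem_nhds (hxW y hy))).congr_of_eventuallyEq ?_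
    filter_upwards [V.isOpen.mem_nhds hy, (W y).isOpen.mem_nhds (hxW y hy)] with x hx hx'
    exact hagree y hy ⟨hx, hx'⟩
  refine ⟨fun x => g x x, hsmooth, fun ψ => ?_⟩
  -- The support of `ψ` meets only finitely many of the `W y`, so finite sums suffice below.
  have hψ : tsupport ψ ⊆ ⋃ y : V, (W y : Set Plane) := fun x hx =>
    mem_iUnion.2 ⟨⟨x, ψ.tsupport_subset hx⟩, hxW x (ψ.tsupport_subset hx)⟩
  obtain ⟨t, ht⟩ := ψ.hasCompactSupport.isCompact.elim_finite_subcover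
    (fun y : V => (W y : Set Plane)) (fun y => (W y).isOpen) hψ
  obtain ⟨ρ, hρ⟩ := SmoothPartitionOfUnity.exists_isSubordinate (modelWithCornersSelf ℝ Plane)
    (isClosed_tsupport ψ) (fun y : t => (W y : Set Plane)) (fun y => (W y).isOpen)
    (by simpa [iUnion_subtype] using ht)
  let ψ' : 𝓓(Ω, ℝ) := extendTo hV ψ
  have hρs : ∀ y, ContDiff ℝ ∞ (ρ y) := fun y => (ρ y).contMDiff.contDiff
  let φ : t → 𝓓(Ω, ℝ) := fun y => mulSmooth ψ' (ρ y) (hρs y)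
  have hsum : ψ' = ∑ y, φ y := by
    ext x
    have h1 : (∑ y, φ y) x = ∑ y, ψ x * ρ y x := by
      simp [φ, ψ']
    rw [h1, ← Finset.mul_sum]
    by_cases hx : x ∈ tsupport ψ
    · have h2 : ∑ᶠ y, ρ y x = 1 := ρ.sum_eq_one hx
      rw [finsum_eq_sum_of_fintype] at h2
      rw [h2, mul_one]
      rfl
    · have h3 : ψ x = 0 := image_eq_zero_of_notMem_tsupport hx
      rw [h3, zero_mul]
      exact h3
  have hφV : ∀ y, tsupport (φ y) ⊆ V := fun y =>
    ((tsupport_mulSmooth_subset _ _ _).trans inter_subset_left).trans ψ.tsupport_subset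
  have hφW : ∀ y : t, tsupport (φ y) ⊆ W y := fun y =>
    ((tsupport_mulSmooth_subset _ _ _).trans inter_subset_right).trans (hρ y)
  have hint : ∀ y : t, T (φ y) = ∫ x, φ y x • g x x := by
    intro y
    rw [apply_eq_integral (hWΩ y y.1.2) (hg y y.1.2) (φ y) (hφW y)]
    refine integral_congr_ae (Eventually.of_forall fun x => ?_)
    by_cases hx : x ∈ tsupport (φ y)
    · exact congrArg (φ y x • ·) (hagree y y.1.2 ⟨hφV y hx, hφW y hx⟩).symm
    · simp [image_eq_zero_of_notMem_tsupport hx]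
  have hoff : ∀ x ∉ (V : Set Plane), ψ x • g x x = 0 := fun x hx => by
    rw [image_eq_zero_of_notMem_tsupport fun h => hx (ψ.tsupport_subset h), zero_smul]
  rw [restrictTo_apply hV T ψ, setIntegral_eq_integral_of_forall_compl_eq_zero hoff,
    show extendTo hV ψ = ∑ y, φ y from hsum, map_sum, Finset.sum_congr rfl fun y _ => hint y,
    ← integral_finsetSum]
  · refine integral_congr_ae (Eventually.of_forall fun x => ?_)
    have h1 : ψ x = (∑ y, φ y) x := by rw [← hsum]; rfl
    have h2 : (∑ y, φ y) x = ∑ y, φ y x := by simp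
    simp only [h1, h2, Finset.sum_smul]
  · exact fun y _ => integrable_smul_of_tsupport_subset V.isOpen (φ y).continuous
      (φ y).hasCompactSupport (hφV y) hsmooth.continuousOn

theorem punctured_le (Ω : Opens Plane) : punctured Ω ≤ Ω := fun _ hx => hx.1

theorem exists_isSmoothDensity_punctured [FiniteDimensional ℝ F] {T : 𝓓'(Ω, F)}
    (hT : T ∈ SingularField Ω F) :
    ∃ f : Plane → F, IsSmoothDensity (restrictTo (punctured Ω) T) f := by
  have := FiniteDimensional.complete ℝ F
  refine exists_isSmoothDensity_of_forall_smoothAt (punctured_le Ω) fun x hx => ?_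
  by_contra hns
  exact hx.2 (hT ⟨subset_closure ⟨hx.1, hns⟩, hx.1⟩)

end Gluing

/-! ### Hadamard's lemma -/

section Hadamard

/-- Differentiating under the integral sign lowers the smoothness of `g` by one and raises the
weight by one, so the family over all weights is stable and the induction closes. -/
theorem contDiff_integral_pow_smul_comp_smul (n : ℕ) {G : Type} [NormedAddCommGroup G]
    [NormedSpace ℝ G] [CompleteSpace G] {g : Plane → G} (hg : ContDiff ℝ ∞ g) (k : ℕ) :
    ContDiff ℝ n fun x => ∫ t in (0 : ℝ)..1, t ^ k • g (t • x) := by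
  induction n generalizing G k with
  | zero =>
    refine contDiff_zero.2
      (intervalIntegral.continuous_parametric_intervalIntegral_of_continuous' ?_ 0 1)
    have := hg.continuous
    fun_prop
  | succ n ih =>
    have hg' : ContDiff ℝ ∞ (fderiv ℝ g) := hg.fderiv_right (by simp)
    refine contDiff_succ_iff_hasFDerivAt.2
      ⟨fun x => ∫ t in (0 : ℝ)..1, t ^ (k + 1) • fderiv ℝ g (t • x), ih hg' (k + 1), fun x₀ => ?_⟩
    have hc : Continuous g := hg.continuous
    have hc' : Continuous (fderiv ℝ g) := hg'.continuous
    have hcF : Continuous fun p : ℝ × Plane => p.1 ^ (k + 1) • fderiv ℝ g (p.1 • p.2) := by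
      fun_prop
    obtain ⟨C, hC⟩ := (isCompact_Icc.prod (isCompact_closedBall x₀ 1)).exists_bound_of_continuousOn
      (f := fun p : ℝ × Plane => p.1 ^ (k + 1) • fderiv ℝ g (p.1 • p.2)) (s := Icc 0 1 ×ˢ _)
      hcF.continuousOn
    refine intervalIntegral.hasFDerivAt_integral_of_dominated_of_fderiv_le (bound := fun _ => C)
      (F' := fun x t => t ^ (k + 1) • fderiv ℝ g (t • x)) (Metric.closedBall_mem_nhds x₀ one_pos)
      (Eventually.of_forall fun x => ?_) ?_ ?_ ?_ ?_ ?_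
    · exact Continuous.aestronglyMeasurable (by fun_prop)
    · exact Continuous.intervalIntegrable (by fun_prop) _ _
    · exact Continuous.aestronglyMeasurable (by fun_prop)
    · refine Eventually.of_forall fun t ht x hx => ?_
      rw [uIoc_of_le zero_le_one] at ht
      exact hC (t, x) ⟨⟨ht.1.le, ht.2⟩, hx⟩
    · exact intervalIntegrable_const
    · refine Eventually.of_forall fun t _ x _ => ?_
      have h1 : HasFDerivAt (fun y : Plane => t • y) (t • ContinuousLinearMap.id ℝ Plane) x :=
        (hasFDerivAt_id x).const_smul t
      have h2 := (((hg.differentiable (by simp)) (t • x)).hasFDerivAt.comp x h1).const_smul (t ^ k)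
      refine h2.congr_fderiv ?_
      ext v
      simp [pow_succ, smul_smul]

theorem eq_sum_smul_e (x : Plane) : x = ∑ j : Fin 2, x j • e j := by
  ext i
  fin_cases i <;> simp [e]

/-- Hadamard's lemma. -/
theorem exists_eq_add_sum_coord_mul {g : Plane → ℝ} (hg : ContDiff ℝ ∞ g) :
    ∃ G : Fin 2 → Plane → ℝ, (∀ j, ContDiff ℝ ∞ (G j)) ∧
      ∀ x, g x = g 0 + ∑ j, x j * G j x := by
  have hg' : ContDiff ℝ ∞ (fderiv ℝ g) := hg.fderiv_right (by simp)
  refine ⟨fun j x => ∫ t in (0 : ℝ)..1, fderiv ℝ g (t • x) (e j), fun j => ?_, fun x => ?_⟩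
  · refine contDiff_infty.2 fun n => ?_
    simpa using contDiff_integral_pow_smul_comp_smul n (hg'.clm_apply contDiff_const) 0
      (g := fun x => fderiv ℝ g x (e j))
  · have hc' : Continuous (fderiv ℝ g) := hg'.continuous
    have h1 : ∀ t ∈ uIcc (0 : ℝ) 1,
        HasDerivAt (fun s : ℝ => g (s • x)) (fderiv ℝ g (t • x) x) t := by
      intro t _
      have h2 : HasDerivAt (fun s : ℝ => s • x) x t := by
        simpa using (hasDerivAt_id t).smul_const x
      exact ((hg.differentiable (by simp)) (t • x)).hasFDerivAt.comp_hasDerivAt t h2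
    have h3 := intervalIntegral.integral_eq_sub_of_hasDerivAt h1
      (Continuous.intervalIntegrable (by fun_prop) _ _)
    have h4 : ∀ t : ℝ, fderiv ℝ g (t • x) x = ∑ j, x j * fderiv ℝ g (t • x) (e j) := by
      intro t
      have h5 := congrArg (fderiv ℝ g (t • x)) (eq_sum_smul_e x)
      rw [map_sum] at h5
      simpa only [map_smul, smul_eq_mul] using h5
    simp only [h4] at h3
    rw [intervalIntegral.integral_finsetSum
      fun j _ => Continuous.intervalIntegrable (by fun_prop) _ _] at h3
    simp only [intervalIntegral.integral_const_mul, one_smul, zero_smul] at h3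
    linarith

end Hadamard

/-! ### Distributions supported at the origin -/

section PointSupport

variable {Ω : Opens Plane} {F : Type*} [NormedAddCommGroup F] [NormedSpace ℝ F]

/-- A distribution which vanishes on the test functions that vanish near the origin. -/
def VanishesOffOrigin (T : 𝓓'(Ω, F)) : Prop :=
  ∀ φ : 𝓓(Ω, ℝ), φ =ᶠ[𝓝 (0 : Plane)] 0 → T φ = 0

theorem VanishesOffOrigin.congr {T : 𝓓'(Ω, F)} (hT : VanishesOffOrigin T) {φ ψ : 𝓓(Ω, ℝ)}
    (h : φ =ᶠ[𝓝 (0 : Plane)] ψ) : T φ = T ψ := by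
  rw [← sub_eq_zero, ← map_sub]
  refine hT _ ?_
  filter_upwards [h] with x hx
  simp [hx]

/-- A distribution has finite order on each compact set. -/
theorem exists_order_bound (T : 𝓓'(Ω, F)) (K : Compacts Plane) (hK : (K : Set Plane) ⊆ Ω) :
    ∃ (N : ℕ) (C : ℝ), ∀ φ : 𝓓(Ω, ℝ), tsupport φ ⊆ K → ∀ M : ℝ,
      (∀ i ≤ N, ∀ x, ‖iteratedFDeriv ℝ i φ x‖ ≤ M) → ‖T φ‖ ≤ C * M := by
  let L : 𝓓_{K}(Plane, ℝ) →L[ℝ] F :=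
    (show 𝓓(Ω, ℝ) →L[ℝ] F from T).comp (TestFunction.ofSupportedInCLM ℝ hK)
  let q : Seminorm ℝ 𝓓_{K}(Plane, ℝ) := (normSeminorm ℝ F).comp L.toLinearMap
  have hq : Continuous q := continuous_norm.comp L.continuous
  obtain ⟨s, C, -, hC⟩ := Seminorm.bound_of_continuous
    (ContDiffMapSupportedIn.withSeminorms ℝ Plane ℝ ⊤ K) q hq
  refine ⟨s.sup id, C, fun φ hφ M hM => ?_⟩
  have hM0 : 0 ≤ M := (norm_nonneg _).trans (hM 0 (Nat.zero_le _) 0)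
  let φ' : 𝓓_{K}(Plane, ℝ) := .of_support_subset φ.contDiff ((subset_tsupport _).trans hφ)
  have h1 : T φ = L φ' := rfl
  have h2 : ‖L φ'‖ ≤ C * (s.sup (ContDiffMapSupportedIn.seminorm ℝ Plane ℝ ⊤ K)) φ' := hC φ'
  rw [h1]
  refine h2.trans (mul_le_mul_of_nonneg_left ?_ C.2)
  refine Seminorm.finset_sup_apply_le hM0 fun i hi => ?_
  exact (ContDiffMapSupportedIn.seminorm_top_le_iff ℝ hM0 i φ').2 fun x _ =>
    hM i (Finset.le_sup (f := id) hi) x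

theorem exists_bound_iteratedFDeriv (φ : 𝓓(Ω, ℝ)) (N : ℕ) :
    ∃ M : ℝ, 0 ≤ M ∧ ∀ i ≤ N, ∀ x, ‖iteratedFDeriv ℝ i φ x‖ ≤ M := by
  have h : ∀ i : ℕ, ∃ M, ∀ x, ‖iteratedFDeriv ℝ i φ x‖ ≤ M := fun i =>
    (φ.contDiff.continuous_iteratedFDeriv (mod_cast le_top)).bounded_above_of_compact_support
      (φ.hasCompactSupport.iteratedFDeriv i)
  choose M hM using h
  have h0 : ∀ i, 0 ≤ M i := fun i => (norm_nonneg _).trans (hM i 0)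
  refine ⟨∑ i ∈ Finset.range (N + 1), M i, Finset.sum_nonneg fun i _ => h0 i, fun i hi x => ?_⟩
  exact (hM i x).trans (Finset.single_le_sum (f := M) (fun i _ => h0 i)
    (Finset.mem_range.2 (Nat.lt_succ_of_le hi)))

/-- The smooth functions on the plane which are homogeneous of degree `m`. -/
structure IsHomog (m : ℕ) (P : Plane → ℝ) : Prop where
  contDiff : ContDiff ℝ ∞ P
  map_smul : ∀ (l : ℝ) (x : Plane), P (l • x) = l ^ m * P x

theorem contDiff_coord (j : Fin 2) : ContDiff ℝ ∞ fun x : Plane => x j := by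
  fun_prop

theorem IsHomog.mul_coord {m : ℕ} {P : Plane → ℝ} (hP : IsHomog m P) (j : Fin 2) :
    IsHomog (m + 1) fun x => P x * x j where
  contDiff := hP.contDiff.mul (contDiff_coord j)
  map_smul l x := by
    simp only [hP.map_smul, PiLp.smul_apply, smul_eq_mul]
    ring

/-- Cutting off at scale `l → 0` shows that a distribution of order `N` on the support of `χ`,
supported at the origin, kills functions vanishing to an order higher than `N`. -/
theorem VanishesOffOrigin.apply_homog_mul_eq_zero {T : 𝓓'(Ω, F)} (hT : VanishesOffOrigin T)
    {χ : 𝓓(Ω, ℝ)} (hχ : χ =ᶠ[𝓝 (0 : Plane)] 1) {N : ℕ} {C : ℝ}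
    (hN : ∀ φ : 𝓓(Ω, ℝ), tsupport φ ⊆ tsupport χ → ∀ M : ℝ,
      (∀ i ≤ N, ∀ x, ‖iteratedFDeriv ℝ i φ x‖ ≤ M) → ‖T φ‖ ≤ C * M)
    {m : ℕ} (hm : N < m) {P g : Plane → ℝ} (hP : IsHomog m P) (hg : ContDiff ℝ ∞ g) :
    T (mulSmooth χ (fun x => P x * g x) (hP.contDiff.mul hg)) = 0 := by
  -- The second cutoff in `G` only makes the derivatives of `g` bounded.
  let η : 𝓓(Ω, ℝ) := mulSmooth χ P hP.contDiff
  let G : 𝓓(Ω, ℝ) := mulSmooth χ g hg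
  obtain ⟨M₁, hM₁, hη⟩ := exists_bound_iteratedFDeriv η N
  obtain ⟨M₂, hM₂, hG⟩ := exists_bound_iteratedFDeriv G N
  have key : ∀ l : ℝ, 0 < l → l < 1 →
      ‖T (mulSmooth χ (fun x => P x * g x) (hP.contDiff.mul hg))‖ ≤
        C * (l * (2 ^ N * M₁ * M₂)) := by
    intro l hl hl1
    -- The factor `χ (x / l) P x`, written so that its scaling in `l` is visible.
    let Q : Plane → ℝ := fun x => l ^ m * η (l⁻¹ • x)
    have hηs : ContDiff ℝ ∞ fun x : Plane => η (l⁻¹ • x) :=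
      η.contDiff.comp (contDiff_const_smul _)
    have hQ : ContDiff ℝ ∞ Q := contDiff_const.mul hηs
    have hgerm : mulSmooth χ (fun x => P x * g x) (hP.contDiff.mul hg) =ᶠ[𝓝 (0 : Plane)]
        mulSmooth G Q hQ := by
      have ht : Tendsto (fun x : Plane => l⁻¹ • x) (𝓝 0) (𝓝 0) := by
        have : Continuous fun x : Plane => l⁻¹ • x := continuous_const_smul _
        simpa using this.tendsto 0
      filter_upwards [ht.eventually hχ] with x hx
      have hx' : χ (l⁻¹ • x) = 1 := hx
      have hpow : l ^ m * l⁻¹ ^ m = 1 := by rw [← mul_pow, mul_inv_cancel₀ hl.ne', one_pow]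
      simp only [mulSmooth_apply, G, Q, η, hx', hP.map_smul]
      linear_combination (-(χ x * P x * g x)) * hpow
    rw [hT.congr hgerm]
    refine hN _ ?_ _ fun j hj x => ?_
    · exact ((tsupport_mulSmooth_subset _ _ _).trans inter_subset_left).trans
        ((tsupport_mulSmooth_subset _ _ _).trans inter_subset_left)
    · have hQb : ∀ i ≤ N, ‖iteratedFDeriv ℝ i Q x‖ ≤ l * M₁ := by
        intro i hi
        have h1 : iteratedFDeriv ℝ i Q x =
            l ^ m • ((l⁻¹) ^ i • iteratedFDeriv ℝ i η (l⁻¹ • x)) := by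
          have h2 : iteratedFDeriv ℝ i Q x =
              l ^ m • iteratedFDeriv ℝ i (fun x : Plane => η (l⁻¹ • x)) x :=
            iteratedFDeriv_const_smul_apply (a := l ^ m) ((hηs.of_le (mod_cast le_top)).contDiffAt)
          rw [h2, iteratedFDeriv_comp_const_smul _ (η.contDiff.of_le (mod_cast le_top))]
        have h3 : l ^ m * (l⁻¹) ^ i ≤ l := by
          rw [inv_pow, ← pow_sub₀ l hl.ne' (by omega)]
          exact pow_le_of_le_one hl.le hl1.le (by omega)
        rw [h1, smul_smul, norm_smul, Real.norm_of_nonneg (by positivity)]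
        exact mul_le_mul h3 (hη i hi _) (norm_nonneg _) hl.le
      refine (norm_iteratedFDeriv_mul_le (n := j) (N := ∞) G.contDiff hQ x
        (mod_cast le_top)).trans ?_
      calc ∑ i ∈ Finset.range (j + 1), (j.choose i : ℝ) * ‖iteratedFDeriv ℝ i G x‖ *
            ‖iteratedFDeriv ℝ (j - i) Q x‖
          ≤ ∑ i ∈ Finset.range (j + 1), (j.choose i : ℝ) * M₂ * (l * M₁) := by
            refine Finset.sum_le_sum fun i hi => ?_
            have hi' : i ≤ j := Nat.lt_succ_iff.1 (Finset.mem_range.1 hi)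
            exact mul_le_mul (mul_le_mul_of_nonneg_left (hG i (hi'.trans hj) x) (Nat.cast_nonneg _))
              (hQb _ ((Nat.sub_le _ _).trans hj)) (norm_nonneg _) (by positivity)
        _ = 2 ^ j * (l * M₁ * M₂) := by
            rw [← Finset.sum_mul, ← Finset.sum_mul, ← Nat.cast_sum, Nat.sum_range_choose]
            push_cast
            ring
        _ ≤ 2 ^ N * (l * M₁ * M₂) := by
            gcongr
            exact one_le_two
        _ = l * (2 ^ N * M₁ * M₂) := by ring
  have hlim : Tendsto (fun l : ℝ => C * (l * (2 ^ N * M₁ * M₂))) (𝓝[>] 0) (𝓝 0) := by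
    have : Continuous fun l : ℝ => C * (l * (2 ^ N * M₁ * M₂)) := by fun_prop
    simpa using (this.tendsto 0).mono_left nhdsWithin_le_nhds
  refine norm_le_zero_iff.1 (ge_of_tendsto hlim ?_)
  filter_upwards [Ioo_mem_nhdsGT (zero_lt_one (α := ℝ))] with l hl using key l hl.1 hl.2

/-- A distribution supported at the origin which kills the cut-off homogeneous functions of
positive degree is a multiple of the Dirac measure: by Hadamard's lemma this reduces, one degree
at a time, to the degrees beyond its order. -/
theorem VanishesOffOrigin.eq_smul_of_homog {T : 𝓓'(Ω, F)} (hT : VanishesOffOrigin T)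
    {χ : 𝓓(Ω, ℝ)} (hχ : χ =ᶠ[𝓝 (0 : Plane)] 1)
    (h : ∀ m, 1 ≤ m → ∀ (P : Plane → ℝ) (hP : IsHomog m P), T (mulSmooth χ P hP.contDiff) = 0)
    (φ : 𝓓(Ω, ℝ)) : T φ = φ 0 • T χ := by
  obtain ⟨N, C, hN⟩ := exists_order_bound T ⟨tsupport χ, χ.hasCompactSupport⟩ χ.tsupport_subset
  -- One step of the descent: if degree `m + 1` is killed, Hadamard's lemma for `g` leaves only the
  -- term `g 0 P` in degree `m`.
  have expand : ∀ (m : ℕ) (P g : Plane → ℝ) (hP : IsHomog m P) (hg : ContDiff ℝ ∞ g),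
      (∀ (Q : Plane → ℝ) (G : Plane → ℝ) (hQ : IsHomog (m + 1) Q) (hG : ContDiff ℝ ∞ G),
        T (mulSmooth χ (fun x => Q x * G x) (hQ.contDiff.mul hG)) = 0) →
      T (mulSmooth χ (fun x => P x * g x) (hP.contDiff.mul hg)) =
        g 0 • T (mulSmooth χ P hP.contDiff) := by
    intro m P g hP hg hnext
    obtain ⟨G, hG, hgG⟩ := exists_eq_add_sum_coord_mul hg
    have h1 : mulSmooth χ (fun x => P x * g x) (hP.contDiff.mul hg) =
        g 0 • mulSmooth χ P hP.contDiff + ∑ j, mulSmooth χ (fun x => P x * x j * G j x)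
          ((hP.mul_coord j).contDiff.mul (hG j)) := by
      ext x
      have h2 : (∑ j, mulSmooth χ (fun x => P x * x j * G j x)
          ((hP.mul_coord j).contDiff.mul (hG j))) x = ∑ j, χ x * (P x * x j * G j x) := by
        simp
      rw [add_apply, h2, mulSmooth_apply, hgG x]
      simp only [smul_apply, mulSmooth_apply, smul_eq_mul, Fin.sum_univ_two]
      ring
    rw [h1, map_add, map_smul, map_sum, Finset.sum_eq_zero, add_zero]
    exact fun j _ => hnext _ _ (hP.mul_coord j) (hG j)
  have descend : ∀ d m : ℕ, m + d = N + 1 → 1 ≤ m → ∀ (P g : Plane → ℝ) (hP : IsHomog m P)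
      (hg : ContDiff ℝ ∞ g), T (mulSmooth χ (fun x => P x * g x) (hP.contDiff.mul hg)) = 0 := by
    intro d
    induction d with
    | zero =>
      intro m hm _ P g hP hg
      exact hT.apply_homog_mul_eq_zero hχ hN (by omega) hP hg
    | succ d ih =>
      intro m hm hm1 P g hP hg
      rw [expand m P g hP hg (ih (m + 1) (by omega) (by omega)), h m hm1 P hP, smul_zero]
  have hone : IsHomog 0 fun _ => 1 := ⟨contDiff_const, by simp⟩
  have h2 := expand 0 _ φ hone φ.contDiff (descend N 1 (by omega) le_rfl)
  have h3 : T (mulSmooth χ (fun _ => 1) hone.contDiff) = T χ := by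
    congr 1
    ext x
    simp
  rw [h3] at h2
  rw [← h2]
  refine hT.congr ?_
  filter_upwards [hχ] with x hx
  simp [hx]

end PointSupport

/-! ### Scaling degree -/

section ERealArithmetic

theorem lt_coe_add_of_sub_lt {a : EReal} {c d : ℝ} (h : a - c < d) : a < ((c + d : ℝ) : EReal) := by
  induction a
  · exact EReal.bot_lt_coe _
  · rw [← EReal.coe_sub, EReal.coe_lt_coe_iff] at h
    exact EReal.coe_lt_coe_iff.2 (by linarith)
  · rw [EReal.top_sub_coe] at h
    exact absurd h not_top_lt

theorem sub_two_le_of_sub_one_le {a b : EReal} (h : a - 1 ≤ b) : a - 2 ≤ b - 2 + 1 := by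
  have h2 : (2 : EReal) = ((2 : ℝ) : EReal) := rfl
  have h1 : (1 : EReal) = ((1 : ℝ) : EReal) := rfl
  rw [h1] at h
  rw [h2, h1]
  have h0 : a - ((2 : ℝ) : EReal) =
      a - ((1 : ℝ) : EReal) - ((2 : ℝ) : EReal) + ((1 : ℝ) : EReal) := by
    induction a
    · simp
    · norm_cast; ring
    · rfl
  rw [h0]
  exact add_le_add_left (EReal.sub_le_sub h le_rfl) _

theorem lt_three_of_sub_two_le {a b : EReal} (h : a - 2 < 0) (hb : b - 2 ≤ a - 2 + 1) : b < 3 := by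
  have h1 : a - 2 + 1 < ((1 : ℝ) : EReal) := by
    have := EReal.add_lt_add_right_coe h 1
    simpa using this
  have h2 := lt_coe_add_of_sub_lt (a := b) (c := 2) (hb.trans_lt h1)
  norm_num at h2
  exact h2

theorem lt_two_of_sub_two_lt {a : EReal} (h : a - 2 < 0) : a < 2 := by
  have h1 := lt_coe_add_of_sub_lt (a := a) (c := 2) (d := 0) h
  rw [add_zero] at h1
  exact h1

end ERealArithmetic

section Scaling

variable {Ω : Opens Plane} {F : Type*} [AddCommGroup F] [Module ℝ F] [TopologicalSpace F]
  [IsTopologicalAddGroup F] [ContinuousSMul ℝ F]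

/-- The exponents `k` with `l ^ k • (T|_{B_r})_l → 0`, whose infimum is the scaling degree. -/
def IsScalingExponent (T : 𝓓'(Ω, F)) (k : ℝ) : Prop :=
  ∀ r : ℝ, 0 < r → ballO r ≤ Ω → ∀ φ : 𝓓(ballO r, ℝ),
    Tendsto (fun l : ℝ => l ^ k • restrictTo (ballO r) T (rescale l φ)) (𝓝[>] 0) (𝓝 0)

theorem IsScalingExponent.scalingDegree_le {T : 𝓓'(Ω, F)} {k : ℝ} (h : IsScalingExponent T k) :
    scalingDegree T ≤ k :=
  iInf₂_le k h

theorem exists_isScalingExponent_of_scalingDegree_lt {T : 𝓓'(Ω, F)} {a : EReal}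
    (h : scalingDegree T < a) : ∃ k : ℝ, IsScalingExponent T k ∧ (k : EReal) < a := by
  obtain ⟨k, hk⟩ := iInf_lt_iff.1 h
  obtain ⟨hk, hka⟩ := iInf_lt_iff.1 hk
  exact ⟨k, hk, hka⟩

theorem IsScalingExponent.add {S T : 𝓓'(Ω, F)} {k : ℝ} (hS : IsScalingExponent S k)
    (hT : IsScalingExponent T k) : IsScalingExponent (S + T) k := by
  intro r hr hrΩ φ
  have h := (hS r hr hrΩ φ).add (hT r hr hrΩ φ)
  rw [add_zero] at h
  refine h.congr fun l => ?_
  rw [← smul_add]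
  rfl

theorem IsScalingExponent.neg {T : 𝓓'(Ω, F)} {k : ℝ} (hT : IsScalingExponent T k) :
    IsScalingExponent (-T) k := by
  intro r hr hrΩ φ
  have h := (hT r hr hrΩ φ).neg
  rw [neg_zero] at h
  refine h.congr fun l => ?_
  rw [← smul_neg]
  rfl

theorem rescale_apply {r l : ℝ} (h : 0 < l ∧ l < 1) (φ : 𝓓(ballO r, ℝ)) (x : Plane) :
    rescale l φ x = (l ^ 2)⁻¹ * φ (l⁻¹ • x) := by
  rw [rescale, dif_pos h]
  rfl

theorem lineDeriv_extendTo_rescale {r l : ℝ} (hrΩ : ballO r ≤ Ω) (h : 0 < l ∧ l < 1)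
    (φ : 𝓓(ballO r, ℝ)) (v : Plane) :
    (∂_{v} (extendTo hrΩ (rescale l φ)) : 𝓓(Ω, ℝ)) =
      l⁻¹ • extendTo hrΩ (rescale l (∂_{v} φ)) := by
  ext x
  have h1 : (extendTo hrΩ (rescale l φ) : Plane → ℝ) = fun x => (l ^ 2)⁻¹ * φ (l⁻¹ • x) :=
    funext (rescale_apply h φ)
  have hd : DifferentiableAt ℝ φ (l⁻¹ • x) := (φ.contDiff.differentiable (by simp)) _
  have h2 : HasFDerivAt (fun y : Plane => l⁻¹ • y) (l⁻¹ • ContinuousLinearMap.id ℝ Plane) x :=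
    (hasFDerivAt_id (𝕜 := ℝ) x).const_smul l⁻¹
  have h3 := (hd.hasFDerivAt.comp x h2).const_smul ((l ^ 2)⁻¹)
  have h4 : fderiv ℝ (fun x => (l ^ 2)⁻¹ * φ (l⁻¹ • x)) x = _ := HasFDerivAt.fderiv h3
  rw [lineDeriv_apply, h1, h4, smul_apply, smul_apply, extendTo_apply, rescale_apply h,
    lineDeriv_apply]
  simp
  ring

theorem IsScalingExponent.tensorDiv {σ : 𝓓'(Ω, SymLin)} {k : ℝ} (h : IsScalingExponent σ k) :
    IsScalingExponent (tensorDiv σ) (k + 1) := by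
  intro r hr hrΩ φ
  have hj : ∀ j, Tendsto (fun l : ℝ => evalSym (e j)
      (l ^ k • restrictTo (ballO r) σ (rescale l (∂_{e j} φ)))) (𝓝[>] 0) (𝓝 0) := fun j => by
    have := ((evalSym (e j)).continuous.tendsto 0).comp (h r hr hrΩ (∂_{e j} φ))
    rwa [(evalSym (e j)).map_zero] at this
  have hsum := (tendsto_finsetSum Finset.univ fun j _ => hj j).neg
  rw [Finset.sum_const_zero, neg_zero] at hsum
  refine hsum.congr' ?_
  filter_upwards [Ioo_mem_nhdsGT (zero_lt_one (α := ℝ))] with l hl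
  rw [restrictTo_apply hrΩ, tensorDiv_apply, smul_neg, Finset.smul_sum]
  congr 1
  refine Finset.sum_congr rfl fun j _ => ?_
  rw [lineDeriv_extendTo_rescale hrΩ hl, map_smul, map_smul, map_smul, smul_smul,
    restrictTo_apply hrΩ, Real.rpow_add_one hl.1.ne', mul_assoc, mul_inv_cancel₀ hl.1.ne', mul_one]

theorem scalingDegree_tensorDiv_le (σ : 𝓓'(Ω, SymLin)) :
    scalingDegree (tensorDiv σ) - 1 ≤ scalingDegree σ := by
  refine le_iInf₂ fun k hk => ?_
  have h : scalingDegree (tensorDiv σ) ≤ ((k + 1 : ℝ) : EReal) :=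
    IsScalingExponent.scalingDegree_le (IsScalingExponent.tensorDiv hk)
  exact EReal.sub_le_of_le_add (by simpa using h)

theorem scalingDegree_neg_le (T : 𝓓'(Ω, F)) : scalingDegree (-T) ≤ scalingDegree T :=
  le_iInf₂ fun _ hk => IsScalingExponent.scalingDegree_le (IsScalingExponent.neg hk)

/-- Differentiation raises the degree of divergence by at most one. -/
theorem deg_neg_tensorDiv_le (σ : 𝓓'(Ω, SymLin)) : deg (-tensorDiv σ) ≤ deg σ + 1 :=
  sub_two_le_of_sub_one_le
    ((EReal.sub_le_sub (scalingDegree_neg_le _) le_rfl).trans (scalingDegree_tensorDiv_le σ))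

end Scaling

section DiracMultiple

variable {Ω : Opens Plane} {F : Type*} [NormedAddCommGroup F] [NormedSpace ℝ F]

theorem IsScalingExponent.mono {T : 𝓓'(Ω, F)} {k k' : ℝ} (h : IsScalingExponent T k)
    (hk : k ≤ k') : IsScalingExponent T k' := by
  intro r hr hrΩ φ
  refine squeeze_zero_norm' ?_ (tendsto_zero_iff_norm_tendsto_zero.1 (h r hr hrΩ φ))
  filter_upwards [Ioo_mem_nhdsGT (zero_lt_one (α := ℝ))] with l hl
  rw [norm_smul, norm_smul, Real.norm_of_nonneg (Real.rpow_nonneg hl.1.le _),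
    Real.norm_of_nonneg (Real.rpow_nonneg hl.1.le _)]
  exact mul_le_mul_of_nonneg_right (Real.rpow_le_rpow_of_exponent_ge hl.1 hl.2.le hk)
    (norm_nonneg _)

/-- Under the scaling, a homogeneous function of degree `m` is multiplied by `l ^ (-2 - m)` near
the origin, which no factor `l ^ k` with `k < 2 + m` compensates; here `k < 3 ≤ 2 + m`. -/
theorem IsScalingExponent.apply_homog_eq_zero {T : 𝓓'(Ω, F)} (hT : VanishesOffOrigin T) {k : ℝ}
    (hk : IsScalingExponent T k) (hk3 : k < 3) {r : ℝ} (hr : 0 < r) (hrΩ : ballO r ≤ Ω)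
    {χ : 𝓓(ballO r, ℝ)} (hχ : χ =ᶠ[𝓝 (0 : Plane)] 1) {m : ℕ} (hm : 1 ≤ m) {P : Plane → ℝ}
    (hP : IsHomog m P) : T (mulSmooth (extendTo hrΩ χ) P hP.contDiff) = 0 := by
  have hlim := tendsto_zero_iff_norm_tendsto_zero.1 (hk r hr hrΩ (mulSmooth χ P hP.contDiff))
  refine norm_le_zero_iff.1 (ge_of_tendsto hlim ?_)
  filter_upwards [Ioo_mem_nhdsGT (zero_lt_one (α := ℝ))] with l hl
  have hgerm : extendTo hrΩ (rescale l (mulSmooth χ P hP.contDiff)) =ᶠ[𝓝 (0 : Plane)]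
      (l ^ (-2 - m : ℝ) • mulSmooth (extendTo hrΩ χ) P hP.contDiff : 𝓓(Ω, ℝ)) := by
    have ht : Tendsto (fun x : Plane => l⁻¹ • x) (𝓝 0) (𝓝 0) := by
      have : Continuous fun x : Plane => l⁻¹ • x := continuous_const_smul _
      simpa using this.tendsto 0
    filter_upwards [hχ, ht.eventually hχ] with x hx hx'
    have hx1 : χ x = 1 := hx
    have hx2 : χ (l⁻¹ • x) = 1 := hx'
    have hl2 : l ^ (-2 - m : ℝ) = (l ^ 2)⁻¹ * l⁻¹ ^ m := by
      rw [sub_eq_add_neg, Real.rpow_add hl.1, Real.rpow_neg hl.1.le, Real.rpow_neg hl.1.le,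
        Real.rpow_natCast, inv_pow]
      norm_cast
    rw [extendTo_apply, rescale_apply hl, smul_apply, mulSmooth_apply, mulSmooth_apply,
      extendTo_apply, hx1, hx2, hP.map_smul, hl2, smul_eq_mul]
    ring
  rw [restrictTo_apply hrΩ, hT.congr hgerm, map_smul, smul_smul, ← Real.rpow_add hl.1, norm_smul,
    Real.norm_of_nonneg (Real.rpow_nonneg hl.1.le _)]
  have hm' : (1 : ℝ) ≤ m := by exact_mod_cast hm
  exact le_mul_of_one_le_left (norm_nonneg _)
    (Real.one_le_rpow_of_pos_of_le_one_of_nonpos hl.1 hl.2.le (by linarith))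

/-- A smooth function supported in the ball of radius `r` and equal to `1` near the origin. -/
theorem exists_cutoff {r : ℝ} (hr : 0 < r) : ∃ χ : 𝓓(ballO r, ℝ), χ =ᶠ[𝓝 (0 : Plane)] 1 := by
  let f : ContDiffBump (0 : Plane) := ⟨r / 4, r / 2, by positivity, by linarith⟩
  refine ⟨⟨f, f.contDiff, f.hasCompactSupport, ?_⟩, f.eventuallyEq_one⟩
  rw [f.tsupport_eq]
  exact Metric.closedBall_subset_ball (show r / 2 < r by linarith)

/-- A distribution supported at the origin of scaling degree below `3` is a multiple of the Dirac
measure. -/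
theorem VanishesOffOrigin.exists_eq_smul {T : 𝓓'(Ω, F)} (hT : VanishesOffOrigin T)
    (hO : (0 : Plane) ∈ Ω) {k : ℝ} (hk : IsScalingExponent T k) (hk3 : k < 3) :
    ∃ c : F, ∀ φ : 𝓓(Ω, ℝ), T φ = φ 0 • c := by
  obtain ⟨r, hr, hrΩ⟩ := Metric.isOpen_iff.1 Ω.isOpen 0 hO
  obtain ⟨χ, hχ⟩ := exists_cutoff hr
  have hrΩ' : ballO r ≤ Ω := hrΩ
  exact ⟨T (extendTo hrΩ' χ), hT.eq_smul_of_homog (χ := extendTo hrΩ' χ) hχ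
    fun m hm P hP => hk.apply_homog_eq_zero hT hk3 hr hrΩ' hχ hm hP⟩

end DiracMultiple

/-! ### Flux through circles -/

section Polar

theorem norm_normal (θ : ℝ) : ‖normal θ‖ = 1 := by
  rw [EuclideanSpace.norm_eq, Fin.sum_univ_two]
  simp [normal]

theorem continuous_normal : Continuous normal := by
  unfold normal
  fun_prop

theorem normal_periodic (θ : ℝ) : normal (θ + 2 * Real.pi) = normal θ := by
  simp [normal]

theorem evalSym_normal (θ : ℝ) (A : SymLin) :
    evalSym (normal θ) A = ∑ j : Fin 2, normal θ j • evalSym (e j) A := by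
  have h := congrArg (A : Plane →L[ℝ] Plane) (eq_sum_smul_e (normal θ))
  rw [map_sum] at h
  simp only [map_smul] at h
  exact h

/-- The measurable equivalence between `ℝ × ℝ` and the plane. -/
def prodEquivPlane : ℝ × ℝ ≃ᵐ Plane :=
  MeasurableEquiv.finTwoArrow.symm.trans (MeasurableEquiv.toLp 2 (Fin 2 → ℝ))

theorem measurePreserving_prodEquivPlane : MeasurePreserving prodEquivPlane :=
  (PiLp.volume_preserving_toLp (Fin 2)).comp (volume_preserving_finTwoArrow ℝ).symm

theorem prodEquivPlane_polarCoord_symm (p : ℝ × ℝ) :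
    prodEquivPlane (polarCoord.symm p) = p.1 • normal p.2 := by
  ext i
  fin_cases i <;> simp [prodEquivPlane, normal]

theorem integral_eq_integral_polar {G : Type*} [NormedAddCommGroup G] [NormedSpace ℝ G]
    {f : Plane → G} (hf : Continuous f) {R : ℝ} (hR : ∀ x, R ≤ ‖x‖ → f x = 0) :
    ∫ x, f x = ∫ r in Ioi (0 : ℝ), ∫ θ in (0 : ℝ)..(2 * Real.pi), r • f (r • normal θ) := by
  rw [← measurePreserving_prodEquivPlane.integral_comp',
    ← integral_comp_polarCoord_symm fun p => f (prodEquivPlane p)]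
  simp only [prodEquivPlane_polarCoord_symm]
  have hc : Continuous fun p : ℝ × ℝ => p.1 • f (p.1 • normal p.2) := by
    have := continuous_normal
    fun_prop
  have hint : IntegrableOn (fun p : ℝ × ℝ => p.1 • f (p.1 • normal p.2))
      (Ioi 0 ×ˢ Ioo (-Real.pi) Real.pi) := by
    refine IntegrableOn.of_forall_sdiff_eq_zero (s := Icc 0 R ×ˢ Icc (-Real.pi) Real.pi)
      (hc.continuousOn.integrableOn_compact (isCompact_Icc.prod isCompact_Icc))
      (measurableSet_Ioi.prod measurableSet_Ioo) fun p hp => ?_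
    have h1 : R ≤ ‖p.1 • normal p.2‖ := by
      by_contra hlt
      rw [norm_smul, norm_normal, mul_one, Real.norm_of_nonneg (le_of_lt hp.1.1)] at hlt
      exact hp.2 ⟨⟨le_of_lt hp.1.1, (not_le.1 hlt).le⟩, Ioo_subset_Icc_self hp.1.2⟩
    rw [hR _ h1, smul_zero]
  rw [show polarCoord.target = Ioi (0 : ℝ) ×ˢ Ioo (-Real.pi) Real.pi from rfl,
    Measure.volume_eq_prod, setIntegral_prod _ hint]
  refine integral_congr_ae (Eventually.of_forall fun r => ?_)
  have hper : Function.Periodic (fun θ => r • f (r • normal θ)) (2 * Real.pi) := fun θ => by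
    simp only [normal_periodic]
  have h2 := hper.intervalIntegral_add_eq (-Real.pi) 0
  rw [zero_add, show -Real.pi + 2 * Real.pi = Real.pi by ring] at h2
  simp only
  rw [← integral_Ioc_eq_integral_Ioo,
    ← intervalIntegral.integral_of_le (by linarith [Real.pi_pos]), h2]

theorem continuousOn_loopIntegral {f : Plane → SymLin} {R : ℝ}
    (hf : ContinuousOn f (Metric.ball 0 R \ {0})) : ContinuousOn (loopIntegral f) (Ioo 0 R) := by
  rw [continuousOn_iff_continuous_domRestrict]
  refine intervalIntegral.continuous_parametric_intervalIntegral_of_continuous' ?_ _ _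
  have h1 : Continuous fun p : Ioo 0 R × ℝ => (p.1 : ℝ) • normal p.2 := by
    have := continuous_normal
    fun_prop
  have h2 : Continuous fun p : Ioo 0 R × ℝ => f ((p.1 : ℝ) • normal p.2) := by
    refine hf.comp_continuous h1 fun p => ?_
    have h3 : ‖(p.1 : ℝ) • normal p.2‖ = p.1 := by
      rw [norm_smul, norm_normal, mul_one, Real.norm_of_nonneg p.1.2.1.le]
    refine ⟨mem_ball_zero_iff.2 (h3.trans_lt p.1.2.2), fun h0 => p.1.2.1.ne ?_⟩
    rw [← h3, h0, norm_zero]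
  simp only [Function.uncurry_def, evalSym_normal]
  refine Continuous.smul (continuous_subtype_val.comp continuous_fst)
    (continuous_finsetSum _ fun j _ => ?_)
  have h4 : Continuous fun p : Ioo 0 R × ℝ => normal p.2 j := by
    have := continuous_normal
    fun_prop
  exact Continuous.smul h4 ((evalSym (e j)).continuous.comp h2)

end Polar

section Radial

theorem hasFDerivAt_norm_plane {x : Plane} (hx : x ≠ 0) :
    HasFDerivAt (fun y : Plane => ‖y‖) (‖x‖⁻¹ • innerSL ℝ x) x := by
  have h1 := (hasStrictFDerivAt_norm_sq x).hasFDerivAt.sqrt (by simpa using hx)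
  simp only [Real.sqrt_sq (norm_nonneg _)] at h1
  refine h1.congr_fderiv ?_
  ext v
  simp
  ring

variable {h : ℝ → ℝ} {R : ℝ}

theorem exists_eq_zero_off_Icc (hc : HasCompactSupport h) (hR : 0 < R)
    (hs : tsupport h ⊆ Ioo 0 R) :
    ∃ a b : ℝ, 0 < a ∧ b < R ∧ ∀ s, s ∉ Icc a b → h s = 0 := by
  -- The point `R / 2` is added because the support may be empty.
  have hK : IsCompact (insert (R / 2) (tsupport h)) := hc.isCompact.insert _
  have hne : (insert (R / 2) (tsupport h)).Nonempty := insert_nonempty _ _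
  have hsub : insert (R / 2) (tsupport h) ⊆ Ioo 0 R :=
    insert_subset ⟨by linarith, by linarith⟩ hs
  refine ⟨_, _, (hsub (hK.sInf_mem hne)).1, (hsub (hK.sSup_mem hne)).2, fun s hsn => ?_⟩
  refine image_eq_zero_of_notMem_tsupport fun hmem => hsn ?_
  exact ⟨csInf_le hK.bddBelow (mem_insert_of_mem _ hmem),
    le_csSup hK.bddAbove (mem_insert_of_mem _ hmem)⟩

/-- A radial test function with prescribed radial derivative `-h`; it is constant, equal to the
integral of `h`, near the origin. -/
theorem exists_radial_testFunction (hh : ContDiff ℝ ∞ h) (hc : HasCompactSupport h) (hR : 0 < R)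
    (hs : tsupport h ⊆ Ioo 0 R) :
    ∃ χ : 𝓓(ballO R, ℝ), χ =ᶠ[𝓝 (0 : Plane)] (fun _ => ∫ s, h s) ∧
      ∀ x : Plane, x ≠ 0 → fderiv ℝ χ x = -(h ‖x‖) • ‖x‖⁻¹ • innerSL ℝ x := by
  obtain ⟨a, b, ha, hb, hab⟩ := exists_eq_zero_off_Icc hc hR hs
  have hcont : Continuous h := hh.continuous
  let G : ℝ → ℝ := fun r => ∫ s in r..R, h s
  have hG' : ∀ r, HasDerivAt G (-h r) r := fun r =>
    intervalIntegral.integral_hasDerivAt_left (hcont.intervalIntegrable _ _)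
      (hcont.stronglyMeasurableAtFilter _ _) hcont.continuousAt
  have hG : ContDiff ℝ ∞ G := by
    refine contDiff_infty_iff_deriv.2 ⟨fun r => (hG' r).differentiableAt, ?_⟩
    rw [show deriv G = fun r => -h r from funext fun r => (hG' r).deriv]
    exact hh.neg
  have hGb : ∀ r, b < r → G r = 0 := fun r hr => by
    refine (intervalIntegral.integral_congr fun s hsr => hab s fun hsab => ?_).trans
      intervalIntegral.integral_zero
    have : min r R ≤ s := hsr.1
    rcases min_le_iff.1 this with h1 | h1 <;> linarith [hsab.2]
  have hGa : ∀ r, r < a → G r = ∫ s, h s := fun r hr => by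
    refine intervalIntegral.integral_eq_integral_of_support_subset fun s hsr => ?_
    have hsab : s ∈ Icc a b := by
      by_contra hn
      exact hsr (hab s hn)
    exact ⟨hr.trans_le hsab.1, hsab.2.trans hb.le⟩
  have hnear : (fun x : Plane => G ‖x‖) =ᶠ[𝓝 0] fun _ => ∫ s, h s := by
    filter_upwards [Metric.ball_mem_nhds (0 : Plane) ha] with x hx
    exact hGa _ (mem_ball_zero_iff.1 hx)
  have hsm : ContDiff ℝ ∞ fun x : Plane => G ‖x‖ := by
    refine contDiff_iff_contDiffAt.2 fun x => ?_
    rcases eq_or_ne x 0 with rfl | hx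
    · exact contDiffAt_const.congr_of_eventuallyEq hnear
    · exact hG.contDiffAt.comp x (contDiffAt_norm ℝ hx)
  have hsupp : tsupport (fun x : Plane => G ‖x‖) ⊆ Metric.closedBall 0 b := by
    refine closure_minimal (fun x hx => ?_) Metric.isClosed_closedBall
    rw [mem_closedBall_zero_iff]
    by_contra hlt
    exact hx (hGb _ (not_le.1 hlt))
  refine ⟨⟨_, hsm, (isCompact_closedBall 0 b).of_isClosed_subset (isClosed_tsupport _) hsupp,
    hsupp.trans (Metric.closedBall_subset_ball hb)⟩, hnear, fun x hx => ?_⟩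
  exact ((hG' ‖x‖).comp_hasFDerivAt x (hasFDerivAt_norm_plane hx)).fderiv

end Radial

section Flux

variable {Ω : Opens Plane} {σ : 𝓓'(Ω, SymLin)} {σ₀ : Plane → SymLin}

/-- The divergence tested against a radial function is a weighted average over the radii of the
fluxes through the circles about the origin. -/
theorem exists_tensorDiv_apply_eq_integral_loopIntegral
    (hσ₀ : IsSmoothDensity (restrictTo (punctured Ω) σ) σ₀) {R : ℝ} (hR : 0 < R)
    (hRΩ : ballO R ≤ Ω) {h : ℝ → ℝ} (hh : ContDiff ℝ ∞ h) (hc : HasCompactSupport h)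
    (hs : tsupport h ⊆ Ioo 0 R) :
    ∃ φ : 𝓓(Ω, ℝ), φ =ᶠ[𝓝 (0 : Plane)] (fun _ => ∫ s, h s) ∧
      tensorDiv σ φ = ∫ r, h r • loopIntegral σ₀ r := by
  obtain ⟨χ, hχ, hdχ⟩ := exists_radial_testFunction hh hc hR hs
  have hd0 : fderiv ℝ χ =ᶠ[𝓝 (0 : Plane)] 0 := by
    refine hχ.fderiv.trans ?_
    simp only [fderiv_fun_const]
    rfl
  -- `χ` is constant near the origin, so its gradient is supported away from the singularity.
  have hsub : ∀ j, tsupport (∂_{e j} (extendTo hRΩ χ) : 𝓓(Ω, ℝ)) ⊆ punctured Ω := by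
    intro j x hx
    refine ⟨TestFunction.tsupport_subset _ hx, fun hx0 => ?_⟩
    rw [mem_singleton_iff.1 hx0] at hx
    refine notMem_tsupport_iff_eventuallyEq.2 ?_ hx
    filter_upwards [hd0] with y hy
    rw [lineDeriv_apply]
    exact congrArg (fun L : Plane →L[ℝ] ℝ => L (e j)) hy
  refine ⟨extendTo hRΩ χ, hχ, ?_⟩
  rw [tensorDiv_apply_eq_integral_gradient (punctured_le Ω) hσ₀ _ hsub]
  let f : Fin 2 → Plane → Plane := fun j x => fderiv ℝ χ x (e j) • evalSym (e j) (σ₀ x)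
  have hfc : ∀ j, Continuous (f j) := by
    intro j
    have h1 : ContinuousOn (fun x => (∂_{e j} (extendTo hRΩ χ) : 𝓓(Ω, ℝ)) x •
        evalSym (e j) (σ₀ x)) (punctured Ω) :=
      ContinuousOn.smul (f := (∂_{e j} (extendTo hRΩ χ) : 𝓓(Ω, ℝ)))
        (TestFunction.continuous _).continuousOn
        ((evalSym (e j)).continuous.comp_continuousOn hσ₀.1.continuousOn)
    have h2 := h1.continuous_of_tsupport_subset (punctured Ω).isOpen
      ((tsupport_smul_subset_left _ _).trans (hsub j))
    simpa only [lineDeriv_apply] using! h2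
  have hf0 : ∀ j x, R ≤ ‖x‖ → f j x = 0 := by
    intro j x hx
    have hx0 : x ≠ 0 := norm_pos_iff.1 (hR.trans_le hx)
    have h1 : h ‖x‖ = 0 := image_eq_zero_of_notMem_tsupport fun hm => hx.not_gt (hs hm).2
    simp [f, hdχ x hx0, h1]
  have hfint : ∀ j, Integrable (f j) := fun j =>
    (hfc j).integrable_of_hasCompactSupport
      (HasCompactSupport.intro (isCompact_closedBall (0 : Plane) R) fun x hx =>
        hf0 j x (not_le.1 fun hle => hx (mem_closedBall_zero_iff.2 hle)).le)
  have hsum : -∑ j, ∫ x, f j x = ∫ x, -∑ j, f j x := by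
    rw [integral_neg, integral_finsetSum _ fun j _ => hfint j]
  have hsc : Continuous fun x => -∑ j, f j x := (continuous_finsetSum _ fun j _ => hfc j).neg
  refine hsum.trans ((integral_eq_integral_polar hsc (R := R) fun x hx => ?_).trans ?_)
  · rw [Finset.sum_eq_zero fun j _ => hf0 j x hx, neg_zero]
  · rw [← setIntegral_eq_integral_of_forall_compl_eq_zero (s := Ioi 0)
      (f := fun r => h r • loopIntegral σ₀ r)]
    · refine setIntegral_congr_fun measurableSet_Ioi fun r (hr : 0 < r) => ?_
      simp only [loopIntegral, ← intervalIntegral.integral_smul]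
      refine intervalIntegral.integral_congr fun θ _ => ?_
      have hn : ‖r • normal θ‖ = r := by
        rw [norm_smul, norm_normal, mul_one, Real.norm_of_nonneg hr.le]
      have h0 : r • normal θ ≠ 0 := norm_pos_iff.1 (hn.symm ▸ hr)
      have h1 : ∀ j, fderiv ℝ χ (r • normal θ) (e j) = -(h r * normal θ j) := by
        intro j
        rw [hdχ _ h0, hn]
        have h2 : inner ℝ (r • normal θ) (e j) = r * normal θ j := by
          simp [e, EuclideanSpace.inner_single_right]
        simp only [smul_apply, innerSL_apply_apply, h2, smul_eq_mul]
        field_simp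
      simp only [f, h1, evalSym_normal, neg_smul, Finset.sum_neg_distrib, neg_neg, mul_smul,
        ← Finset.smul_sum]
      rw [smul_comm]
    · intro r hr
      have h1 : h r = 0 := image_eq_zero_of_notMem_tsupport fun hm => hr (hs hm).1
      rw [h1, zero_smul]

/-- The flux through every circle about the origin is determined by the values of the divergence on
the test functions which are constant near the origin. -/
theorem loopIntegral_eq_of_tensorDiv_apply
    (hσ₀ : IsSmoothDensity (restrictTo (punctured Ω) σ) σ₀) {ε : ℝ} (hε : 0 < ε)
    (hεΩ : Metric.closedBall (0 : Plane) ε ⊆ Ω) {v : Plane}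
    (hv : ∀ (φ : 𝓓(Ω, ℝ)) (c : ℝ), φ =ᶠ[𝓝 (0 : Plane)] (fun _ => c) → tensorDiv σ φ = c • v) :
    loopIntegral σ₀ ε = v := by
  obtain ⟨δ, hδ, hδΩ⟩ := (isCompact_closedBall (0 : Plane) ε).exists_thickening_subset_open
    Ω.isOpen hεΩ
  rw [thickening_closedBall hδ hε.le] at hδΩ
  have hRΩ : ballO (δ + ε) ≤ Ω := hδΩ
  have hR : 0 < δ + ε := by positivity
  have hL : ContinuousOn (loopIntegral σ₀) (Ioo 0 (δ + ε)) :=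
    continuousOn_loopIntegral (hσ₀.1.continuousOn.mono fun x hx => ⟨hRΩ hx.1, hx.2⟩)
  have hLv : ContinuousOn (fun r => loopIntegral σ₀ r - v) (Ioo 0 (δ + ε)) :=
    hL.sub continuousOn_const
  have hae : ∀ᵐ r, r ∈ Ioo 0 (δ + ε) → loopIntegral σ₀ r - v = 0 := by
    refine isOpen_Ioo.ae_eq_zero_of_integral_contDiff_smul_eq_zero
      (hLv.locallyIntegrableOn measurableSet_Ioo) fun h hh hc hs => ?_
    obtain ⟨φ, hφ, hφL⟩ := exists_tensorDiv_apply_eq_integral_loopIntegral hσ₀ hR hRΩ hh hc hs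
    rw [hv φ _ hφ] at hφL
    simp only [smul_sub]
    rw [integral_sub, ← hφL, integral_smul_const, sub_self]
    · exact integrable_smul_of_tsupport_subset isOpen_Ioo hh.continuous hc hs hL
    · exact integrable_smul_of_tsupport_subset isOpen_Ioo hh.continuous hc hs continuousOn_const
  have heq := Measure.eqOn_open_of_ae_eq ((ae_restrict_iff' measurableSet_Ioo).2 hae) isOpen_Ioo
    hLv continuousOn_const
  exact sub_eq_zero.1 (heq (show ε ∈ Ioo 0 (δ + ε) from ⟨hε, by linarith⟩))

end Flux

/-! ### Point forces and equilibrium -/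

section PointForces

variable {Ω : Opens Plane} {F : Type*} [NormedAddCommGroup F] [NormedSpace ℝ F]

theorem tsupport_subset_punctured {φ : 𝓓(Ω, ℝ)} (hφ : φ =ᶠ[𝓝 (0 : Plane)] 0) :
    tsupport φ ⊆ punctured Ω := fun _ hx =>
  ⟨φ.tsupport_subset hx, fun hx0 =>
    notMem_tsupport_iff_eventuallyEq.2 hφ (mem_singleton_iff.1 hx0 ▸ hx)⟩

theorem lineDeriv_eventuallyEq_zero {φ : 𝓓(Ω, ℝ)} {c : ℝ} (hφ : φ =ᶠ[𝓝 (0 : Plane)] fun _ => c)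
    (v : Plane) : (∂_{v} φ : 𝓓(Ω, ℝ)) =ᶠ[𝓝 (0 : Plane)] 0 := by
  filter_upwards [hφ.fderiv (𝕜 := ℝ)] with _ hx
  rw [lineDeriv_apply, hx]
  simp

theorem VanishesOffOrigin.lineDeriv {T : 𝓓'(Ω, F)} (hT : VanishesOffOrigin T) (v : Plane) :
    VanishesOffOrigin (∂_{v} T : 𝓓'(Ω, F)) := fun φ hφ => by
  rw [Distribution.lineDerivOp_apply_apply, map_neg,
    hT _ (lineDeriv_eventuallyEq_zero (c := 0) hφ v), neg_zero]

theorem VanishesOffOrigin.iterate_lineDeriv {T : 𝓓'(Ω, F)} (hT : VanishesOffOrigin T) (v : Plane)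
    (n : ℕ) : VanishesOffOrigin ((fun S : 𝓓'(Ω, F) => ∂_{v} S)^[n] T) := by
  induction n with
  | zero => exact hT
  | succ n ih =>
    rw [Function.iterate_succ_apply']
    exact ih.lineDeriv v

theorem VanishesOffOrigin.iterate_succ_lineDeriv_apply {T : 𝓓'(Ω, F)} (hT : VanishesOffOrigin T)
    (v : Plane) (n : ℕ) {φ : 𝓓(Ω, ℝ)} {c : ℝ} (hφ : φ =ᶠ[𝓝 (0 : Plane)] fun _ => c) :
    (fun S : 𝓓'(Ω, F) => ∂_{v} S)^[n + 1] T φ = 0 := by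
  rw [Function.iterate_succ_apply', Distribution.lineDerivOp_apply_apply, map_neg,
    hT.iterate_lineDeriv v n _ (lineDeriv_eventuallyEq_zero hφ v), neg_zero]

theorem vanishesOffOrigin_delta : VanishesOffOrigin (Distribution.delta 0 : 𝓓'(Ω, ℝ)) :=
  fun _ hφ => hφ.eq_of_nhds

theorem vanishesOffOrigin_deltaDeriv (α : ℕ × ℕ) : VanishesOffOrigin (deltaDeriv Ω α) :=
  (vanishesOffOrigin_delta.iterate_lineDeriv _ _).iterate_lineDeriv _ _

theorem deltaDeriv_apply_of_eventuallyEq_const (α : ℕ × ℕ) {φ : 𝓓(Ω, ℝ)} {c : ℝ}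
    (hφ : φ =ᶠ[𝓝 (0 : Plane)] fun _ => c) :
    deltaDeriv Ω α φ = if α = (0, 0) then c else 0 := by
  obtain ⟨m, n⟩ := α
  cases m with
  | succ m =>
    rw [if_neg (by simp)]
    exact (vanishesOffOrigin_delta.iterate_lineDeriv _ _).iterate_succ_lineDeriv_apply _ _ hφ
  | zero =>
    cases n with
    | succ n =>
      rw [if_neg (by simp)]
      exact vanishesOffOrigin_delta.iterate_succ_lineDeriv_apply _ _ hφ
    | zero =>
      rw [if_pos rfl]
      exact hφ.eq_of_nhds

theorem sum_vecMul_deltaDeriv_apply (b : (ℕ × ℕ) →₀ F) (φ : 𝓓(Ω, ℝ)) :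
    (∑ α ∈ b.support, vecMul (b α) (deltaDeriv Ω α)) φ =
      ∑ α ∈ b.support, deltaDeriv Ω α φ • b α := by
  simp [vecMul]

theorem vanishesOffOrigin_sum_vecMul_deltaDeriv (b : (ℕ × ℕ) →₀ F) :
    VanishesOffOrigin (∑ α ∈ b.support, vecMul (b α) (deltaDeriv Ω α)) := fun φ hφ => by
  rw [sum_vecMul_deltaDeriv_apply]
  refine Finset.sum_eq_zero fun α _ => ?_
  rw [vanishesOffOrigin_deltaDeriv α φ hφ, zero_smul]

theorem sum_vecMul_deltaDeriv_apply_of_eventuallyEq_const (b : (ℕ × ℕ) →₀ F) {φ : 𝓓(Ω, ℝ)} {c : ℝ}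
    (hφ : φ =ᶠ[𝓝 (0 : Plane)] fun _ => c) :
    (∑ α ∈ b.support, vecMul (b α) (deltaDeriv Ω α)) φ = c • b (0, 0) := by
  rw [sum_vecMul_deltaDeriv_apply, Finset.sum_eq_single (0, 0)]
  · rw [deltaDeriv_apply_of_eventuallyEq_const _ hφ, if_pos rfl]
  · intro α _ hα
    rw [deltaDeriv_apply_of_eventuallyEq_const _ hφ, if_neg hα, zero_smul]
  · intro h0
    rw [Finsupp.notMem_support_iff.1 h0, smul_zero]

end PointForces

section Equilibrium

variable {Ω : Opens Plane} {σ : 𝓓'(Ω, SymLin)} {σ₀ : Plane → SymLin} {B : 𝓓'(Ω, Plane)}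

theorem divergence_eq_zero_of_equilibrium
    (hσ₀ : IsSmoothDensity (restrictTo (punctured Ω) σ) σ₀) (hB : VanishesOffOrigin B)
    (heq : tensorDiv σ + B = 0) : ∀ x ∈ punctured Ω, divergence σ₀ x = 0 := by
  refine eqOn_zero_of_integral_smul_eq_zero (continuousOn_divergence hσ₀.1) fun φ => ?_
  have h1 := tensorDiv_apply_eq_integral_divergence (punctured_le Ω) hσ₀
    (extendTo (punctured_le Ω) φ) φ.tsupport_subset
  have h2 : tensorDiv σ = -B := eq_neg_of_add_eq_zero_left heq
  have h3 : extendTo (punctured_le Ω) φ =ᶠ[𝓝 (0 : Plane)] 0 :=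
    notMem_tsupport_iff_eventuallyEq.1 fun h0 => (φ.tsupport_subset h0).2 rfl
  have h4 : tensorDiv σ (extendTo (punctured_le Ω) φ) = 0 := by
    rw [h2]
    exact neg_eq_zero.2 (hB _ h3)
  exact h1.symm.trans h4

theorem vanishesOffOrigin_tensorDiv (hσ₀ : IsSmoothDensity (restrictTo (punctured Ω) σ) σ₀)
    (hdiv : ∀ x ∈ punctured Ω, divergence σ₀ x = 0) : VanishesOffOrigin (tensorDiv σ) := by
  intro φ hφ
  have hs := tsupport_subset_punctured hφ
  rw [tensorDiv_apply_eq_integral_divergence (punctured_le Ω) hσ₀ φ hs]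
  refine integral_eq_zero_of_ae (Eventually.of_forall fun x => ?_)
  by_cases hx : x ∈ tsupport φ
  · simp [hdiv x (hs hx)]
  · simp [image_eq_zero_of_notMem_tsupport hx]

theorem loopIntegral_eq_of_equilibrium (hσ₀ : IsSmoothDensity (restrictTo (punctured Ω) σ) σ₀)
    {b : (ℕ × ℕ) →₀ Plane} (hb : B = ∑ α ∈ b.support, vecMul (b α) (deltaDeriv Ω α)) {ε : ℝ}
    (hε : 0 < ε) (hεΩ : Metric.closedBall (0 : Plane) ε ⊆ Ω) {c : Plane}
    (heq : ∀ φ : 𝓓(Ω, ℝ), (tensorDiv σ + B) φ = φ 0 • c) :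
    loopIntegral σ₀ ε = c - b (0, 0) := by
  refine loopIntegral_eq_of_tensorDiv_apply hσ₀ hε hεΩ fun φ s hφ => ?_
  have h1 : tensorDiv σ φ + B φ = φ 0 • c := heq φ
  rw [hb, sum_vecMul_deltaDeriv_apply_of_eventuallyEq_const b hφ, hφ.eq_of_nhds] at h1
  rw [smul_sub]
  exact eq_sub_of_add_eq h1

/-- If `deg σ < 0`, equilibrium off the origin and the degree bound leave only a multiple
of the Dirac measure as residual, and the flux condition removes it. -/
theorem equilibrium_of_deg_lt_zero (hO : (0 : Plane) ∈ Ω)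
    (hσ₀ : IsSmoothDensity (restrictTo (punctured Ω) σ) σ₀)
    {b : (ℕ × ℕ) →₀ Plane} (hb : B = ∑ α ∈ b.support, vecMul (b α) (deltaDeriv Ω α)) {ε : ℝ}
    (hε : 0 < ε) (hεΩ : Metric.closedBall (0 : Plane) ε ⊆ Ω) (hσ : deg σ < 0)
    (hdiv : ∀ x ∈ punctured Ω, divergence σ₀ x = 0) (hflux : loopIntegral σ₀ ε = - b (0, 0))
    (hdeg : deg B ≤ deg σ + 1) : tensorDiv σ + B = 0 := by
  obtain ⟨k, hk, hk2⟩ :=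
    exists_isScalingExponent_of_scalingDegree_lt (lt_two_of_sub_two_lt hσ)
  obtain ⟨k', hk', hk3⟩ :=
    exists_isScalingExponent_of_scalingDegree_lt (lt_three_of_sub_two_le hσ hdeg)
  have hk2' : k < 2 := EReal.coe_lt_coe_iff.1 hk2
  have hk3' : k' < 3 := EReal.coe_lt_coe_iff.1 hk3
  have hD : VanishesOffOrigin (tensorDiv σ + B) := fun φ hφ => by
    have h1 := vanishesOffOrigin_tensorDiv hσ₀ hdiv φ hφ
    have h2 : B φ = 0 := hb ▸ vanishesOffOrigin_sum_vecMul_deltaDeriv b φ hφ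
    calc (tensorDiv σ + B) φ = tensorDiv σ φ + B φ := rfl
      _ = 0 := by rw [h1, h2, add_zero]
  -- Both exponents are below `3`: `k + 1` because `k < 2`, and `k'` by the bound on `deg B`.
  have hexp : IsScalingExponent (tensorDiv σ + B) (max (k + 1) k') :=
    (hk.tensorDiv.mono (le_max_left _ _)).add (hk'.mono (le_max_right _ _))
  obtain ⟨c, hc⟩ := hD.exists_eq_smul hO hexp (max_lt (by linarith) hk3')
  have hc0 : c = 0 := by
    have h := loopIntegral_eq_of_equilibrium hσ₀ hb hε hεΩ hc
    rw [hflux, sub_eq_add_neg] at h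
    exact right_eq_add.1 h
  ext1 φ
  rw [hc φ, hc0, smul_zero]
  rfl

end Equilibrium

end PlaneStress

end

open PlaneStress in
theorem mainTheorem5 (Ω : Opens Plane) (hO : (0 : Plane) ∈ Ω)
    (σ : 𝓓'(Ω, SymLin)) (hσ : σ ∈ SingularField Ω SymLin)
    (B : 𝓓'(Ω, Plane)) (hB : B ∈ PointField Ω Plane)
    (b : (ℕ × ℕ) →₀ Plane) (hb : B = ∑ α ∈ b.support, vecMul (b α) (deltaDeriv Ω α)) :
    (∃ σ₀ : Plane → SymLin, IsSmoothDensity (restrictTo (punctured Ω) σ) σ₀) ∧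
    ∀ σ₀ : Plane → SymLin, IsSmoothDensity (restrictTo (punctured Ω) σ) σ₀ →
      ∀ ε : ℝ, 0 < ε → Metric.closedBall (0 : Plane) ε ⊆ Ω →
        (tensorDiv σ + B = 0 →
          (∀ x ∈ punctured Ω, divergence σ₀ x = 0) ∧
          loopIntegral σ₀ ε = - b (0, 0) ∧
          deg B ≤ deg σ + 1) ∧
        (deg σ < 0 →
          (tensorDiv σ + B = 0 ↔
            (∀ x ∈ punctured Ω, divergence σ₀ x = 0) ∧
            loopIntegral σ₀ ε = - b (0, 0) ∧
            deg B ≤ deg σ + 1)) := by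
  refine ⟨exists_isSmoothDensity_punctured hσ, fun σ₀ hσ₀ ε hε hεΩ => ?_⟩
  have hnec : tensorDiv σ + B = 0 → (∀ x ∈ punctured Ω, divergence σ₀ x = 0) ∧
      loopIntegral σ₀ ε = - b (0, 0) ∧ deg B ≤ deg σ + 1 := by
    intro heq
    refine ⟨divergence_eq_zero_of_equilibrium hσ₀
      (hb ▸ vanishesOffOrigin_sum_vecMul_deltaDeriv b) heq, ?_, ?_⟩
    · have h := loopIntegral_eq_of_equilibrium hσ₀ hb hε hεΩ (c := 0) fun φ => by
        rw [heq, smul_zero]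
        rfl
      rwa [zero_sub] at h
    · rw [eq_neg_of_add_eq_zero_right heq]
      exact deg_neg_tensorDiv_le σ
  exact ⟨hnec, fun hdeg => ⟨hnec, fun ⟨hdiv, hflux, hle⟩ =>
    equilibrium_of_deg_lt_zero hO hσ₀ hb hε hεΩ hdeg hdiv hflux hle⟩⟩
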